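/- Let $\lambda$ be Lebesgue measure on $[0,1)$, let $f:[0,1)\to[0,1)$ be a $\lambda$-preserving (Lebesgue measurable) ergodic transformation, and let $(b_i)_{i\ge 1}$ be a decreasing (not necessarily strictly) sequence of positive real numbers with $\sum_{i\ge 1} b_i=\infty$. For $\alpha\in[0,1)$ let $R_\alpha(x)=x+\alpha-\lfloor x+\alpha\rfloor$ be the rotation of $[0,1)$ by $\alpha$, and for $x\in[0,1)$, $r>0$ let $B(x,r)=\{y\in[0,1): |y-x|<r\}$. Then $$\lambda\Big(\bigcap_{n=1}^{\infty}\bigcup_{i=n}^{\infty} f^{-i}\big(B(R_\alpha^i x,b_i)\big)\Big)=1$$ for almost every $\alpha\in[0,1)$ and almost every $x\in[0,1)$, that is, for $\lambda\times\lambda$-almost every pair $(\alpha,x)\in[0,1)^2$. -/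

import Mathlib

open MeasureTheory

/-- The unit interval `[0,1)`, as a subtype of the real line, with the Euclidean distance. -/
abbrev UnitIco : Type := Set.Ico (0 : ℝ) 1

/-- Lebesgue measure on `[0,1)`. -/
noncomputable def lebesgueIco : Measure UnitIco := Measure.comap Subtype.val volume

/-- `f : [0,1) → [0,1)` is an ergodic Lebesgue-measure-preserving transformation, with respect to
the σ-algebra of all Lebesgue measurable sets (the completion of the Borel σ-algebra). Every Borel
measurable ergodic measure-preserving map of `[0,1)` satisfies this as well. -/
def IsLebesgueErgodic (f : UnitIco → UnitIco) : Prop :=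
  Ergodic (α := NullMeasurableSpace UnitIco lebesgueIco) f lebesgueIco.completion

/-- Rotation of `[0,1)` by `α`: `x ↦ x + α - ⌊x + α⌋`. -/
noncomputable def rotationIco (α x : UnitIco) : UnitIco :=
  ⟨(x : ℝ) + α - ⌊(x : ℝ) + α⌋, Int.fract_nonneg _, Int.fract_lt_one _⟩

/-- The limsup set `⋂_{n ≥ 1} ⋃_{i ≥ n} f⁻ⁱ(B(R_αⁱ x, b_i))`. -/
def hittingSet (f : UnitIco → UnitIco) (b : ℕ → ℝ) (α x : UnitIco) : Set UnitIco :=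
  ⋂ n ≥ 1, ⋃ i ≥ n, f^[i] ⁻¹' Metric.ball ((rotationIco α)^[i] x) (b i)

open Filter Set Topology ProbabilityTheory
open scoped ENNReal

/-! By Fubini it suffices to fix `y` and vary `(α, x)`. The centres `f^[i] y` are then a fixed
sequence `z i`, and the symmetry of distance turns the question into whether the random point `R_α^i
x` falls in `B(z i, b i)` infinitely often. On the torus, `(α, x) ↦ (x + iα, x + jα)` is a
surjective endomorphism for `i ≠ j`, so it preserves Haar measure: the points `R_α^i x` are uniform
and pairwise independent. The balls have measure at least `min (b i) 1`, a divergent series, so the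
pairwise Borel–Cantelli lemma applies. -/

/-- The second Borel–Cantelli lemma for pairwise independent events. -/
theorem ae_frequently_mem_of_pairwise_indepFun {Ω : Type*} [MeasurableSpace Ω] {μ : Measure Ω}
    [IsProbabilityMeasure μ] {E : ℕ → Set Ω} (hE : ∀ i, MeasurableSet (E i))
    (hind : Pairwise fun i j =>
      IndepFun ((E i).indicator (1 : Ω → ℝ)) ((E j).indicator (1 : Ω → ℝ)) μ)
    (hdiv : ¬ Summable fun i => μ.real (E i)) :
    ∀ᵐ ω ∂μ, ∃ᶠ i in atTop, ω ∈ E i := by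
  set a : ℕ → ℝ := fun n => ∑ i ∈ Finset.range n, μ.real (E i) with ha
  have ha_top : Tendsto a atTop atTop :=
    (not_summable_iff_tendsto_nat_atTop_of_nonneg fun _ => measureReal_nonneg).1 hdiv
  set X : ℕ → Ω → ℝ := fun i => (E i).indicator 1 with hX
  have hXm : ∀ i, MemLp (X i) 2 μ := fun i =>
    memLp_indicator_const 2 (hE i) (1 : ℝ) (Or.inr (measure_ne_top μ _))
  have hXi : ∀ i, ∫ ω, X i ω ∂μ = μ.real (E i) := fun i => integral_indicator_one (hE i)
  set S : ℕ → Ω → ℝ := fun n => ∑ i ∈ Finset.range n, X i with hS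
  have hSm : ∀ n, MemLp (S n) 2 μ := fun n => memLp_finsetSum' _ fun i _ => hXm i
  have hSi : ∀ n, ∫ ω, S n ω ∂μ = a n := fun n => by
    simp only [hS, Finset.sum_apply]
    rw [integral_finsetSum _ fun i _ => (hXm i).integrable (by norm_num)]
    simp [hXi, ha]
  -- Variances add under pairwise independence, and an indicator equals its square.
  have hVar : ∀ n, Var[S n; μ] ≤ a n := fun n => by
    rw [hS, IndepFun.variance_sum (fun i _ => hXm i) (fun i _ j _ hij => hind hij)]
    refine Finset.sum_le_sum fun i _ => ?_
    refine (variance_le_expectation_sq (hXm i).1).trans (le_of_eq ?_)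
    rw [← hXi i]
    congr 1
    ext ω
    by_cases h : ω ∈ E i <;> simp [hX, h]
  -- Chebyshev: once `a n ≥ 2 * M`, the bound `S n ≤ M` forces a deviation of at least `a n / 2`
  -- from the mean, an event of probability at most `4 / a n → 0`.
  have hnull : ∀ M : ℕ, μ {ω | ∀ n, S n ω ≤ M} = 0 := fun M => by
    have hlim : Tendsto (fun n => ENNReal.ofReal (4 / a n)) atTop (𝓝 0) := by
      simpa using ENNReal.tendsto_ofReal (ha_top.const_div_atTop 4)
    refine le_antisymm (ge_of_tendsto hlim ?_) zero_le
    filter_upwards [ha_top.eventually_ge_atTop (2 * M), ha_top.eventually_gt_atTop 0] with n h1 h2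
    have hpos : 0 < a n / 2 := by positivity
    calc μ {ω | ∀ n, S n ω ≤ M} ≤ μ {ω | a n / 2 ≤ |S n ω - ∫ ω, S n ω ∂μ|} := by
          refine measure_mono fun ω hω => ?_
          have := hω n
          rw [mem_ofPred_eq, hSi, abs_sub_comm]
          exact le_trans (by linarith) (le_abs_self _)
      _ ≤ ENNReal.ofReal (Var[S n; μ] / (a n / 2) ^ 2) := meas_ge_le_variance_div_sq (hSm n) hpos
      _ ≤ ENNReal.ofReal (4 / a n) := by
          refine ENNReal.ofReal_le_ofReal ?_
          calc Var[S n; μ] / (a n / 2) ^ 2 ≤ a n / (a n / 2) ^ 2 := by gcongr; exact hVar n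
            _ = 4 / a n := by field_simp; norm_num
  have hall : ∀ᵐ ω ∂μ, ∀ M : ℕ, ¬ ∀ n, S n ω ≤ M :=
    ae_all_iff.2 fun M => by simpa [ae_iff] using hnull M
  filter_upwards [hall] with ω hω hfin
  obtain ⟨M, hM⟩ := eventually_atTop.1 hfin
  refine hω M fun n => ?_
  have hle : ∀ i, X i ω ≤ if i < M then 1 else 0 := fun i => by
    by_cases hi : i < M
    · simp only [hX, hi, if_true]
      exact indicator_apply_le' (fun _ => le_rfl) fun _ => zero_le_one
    · simp [hX, hi, hM i (not_lt.1 hi)]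
  calc S n ω = ∑ i ∈ Finset.range n, X i ω := by simp [hS]
    _ ≤ ∑ i ∈ Finset.range n, if i < M then (1 : ℝ) else 0 := Finset.sum_le_sum fun i _ => hle i
    _ = ((Finset.range n).filter (· < M)).card := by simp
    _ ≤ (Finset.range M).card := by
        gcongr
        intro i
        simp
    _ = M := by simp

/-- Each measurable `s` is the preimage of `g '' s`, so both measures of `s` equal `κ (g '' s)`.
This brings the torus computation back to `[0,1)²`. -/
theorem MeasureTheory.MeasurePreserving.of_comp_measurableEmbedding {Ω β γ : Type*}
    [MeasurableSpace Ω] [MeasurableSpace β] [MeasurableSpace γ] {μ : Measure Ω} {ν : Measure β}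
    {κ : Measure γ} {g : β → γ} {Y : Ω → β} (hg : MeasurePreserving g ν κ)
    (hge : MeasurableEmbedding g) (hY : Measurable Y) (h : MeasurePreserving (g ∘ Y) μ κ) :
    MeasurePreserving Y μ ν := by
  refine ⟨hY, ?_⟩
  ext s hs
  have hs' := hge.measurableSet_image.2 hs
  rw [Measure.map_apply hY hs]
  nth_rw 1 [← hge.injective.preimage_image s]
  nth_rw 2 [← hge.injective.preimage_image s]
  rw [← preimage_comp, h.measure_preimage hs'.nullMeasurableSet,
    hg.measure_preimage hs'.nullMeasurableSet]

/-- For distinct `m n : ℤ`, `(α, x) ↦ (x + m α, x + n α)` preserves Haar measure of the torus. -/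
theorem UnitAddCircle.measurePreserving_add_zsmul_prod {m n : ℤ} (hmn : m ≠ n) :
    MeasurePreserving
      (fun p : UnitAddCircle × UnitAddCircle => (p.2 + m • p.1, p.2 + n • p.1))
      (volume.prod volume) (volume.prod volume) := by
  let φ : UnitAddCircle × UnitAddCircle →+ UnitAddCircle × UnitAddCircle :=
    AddMonoidHom.prod
      (AddMonoidHom.snd UnitAddCircle UnitAddCircle + m • AddMonoidHom.fst _ _)
      (AddMonoidHom.snd UnitAddCircle UnitAddCircle + n • AddMonoidHom.fst _ _)
  -- A continuous surjective homomorphism of compact groups carries Haar measure to Haar measure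
  -- when the total masses agree.
  refine φ.measurePreserving (μ := (volume.prod volume)) (ν := (volume.prod volume))
    ?_ ?_ rfl
  · change Continuous
      fun p : UnitAddCircle × UnitAddCircle => (p.2 + m • p.1, p.2 + n • p.1)
    fun_prop
  -- Surjectivity: the circle is divisible, so `(m - n) • a = u - v` has a solution.
  · rintro ⟨u, v⟩
    obtain ⟨a, ha⟩ : ∃ a : UnitAddCircle, (m - n) • a = u - v :=
      ⟨_, DivisibleBy.div_cancel (u - v) (sub_ne_zero.2 hmn)⟩
    simp only [sub_smul] at ha
    refine ⟨(a, u - m • a), Prod.ext ?_ ?_⟩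
    · simp [φ]
    · change u - m • a + n • a = v
      rw [sub_add, ha, sub_sub_cancel]

theorem measurableEmbedding_coe_unitIco : MeasurableEmbedding (Subtype.val : UnitIco → ℝ) :=
  MeasurableEmbedding.subtype_coe measurableSet_Ico

instance : StandardBorelSpace UnitIco := measurableSet_Ico.standardBorel

theorem lebesgueIco_apply (s : Set UnitIco) : lebesgueIco s = volume (Subtype.val '' s) :=
  measurableEmbedding_coe_unitIco.comap_apply _ _

instance : IsProbabilityMeasure lebesgueIco := ⟨by
  rw [lebesgueIco_apply, image_univ, Subtype.range_coe]; simp⟩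

/-- The bijection of `[0,1)` with the circle `ℝ / ℤ`. -/
noncomputable def UnitIco.toCircle (x : UnitIco) : UnitAddCircle := ((x : ℝ) : UnitAddCircle)

theorem UnitIco.measurePreserving_toCircle :
    MeasurePreserving UnitIco.toCircle lebesgueIco volume := by
  have h1 : MeasurePreserving (Subtype.val : UnitIco → ℝ) lebesgueIco
      (volume.restrict (Ico 0 1)) := measurePreserving_subtype_coe measurableSet_Ico
  have h2 := UnitAddCircle.measurePreserving_mk 0
  rw [zero_add, ← Measure.restrict_congr_set (Ico_ae_eq_Ioc (μ := volume) (a := (0 : ℝ)) (b := 1))] at h2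
  exact h2.comp h1

theorem UnitIco.injective_toCircle : Function.Injective UnitIco.toCircle := fun x y h =>
  Subtype.ext <| (AddCircle.coe_eq_coe_iff_of_mem_Ico (p := (1 : ℝ)) (a := 0)
    (by simp) (by simp)).1 h

theorem UnitIco.measurableEmbedding_toCircle : MeasurableEmbedding UnitIco.toCircle :=
  measurePreserving_toCircle.measurable.measurableEmbedding injective_toCircle

theorem UnitIco.toCircle_rotationIco (α x : UnitIco) :
    (rotationIco α x).toCircle = x.toCircle + α.toCircle := by
  simp only [toCircle, rotationIco, AddCircle.coe_sub, AddCircle.coe_add]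
  have : ((⌊(x : ℝ) + α⌋ : ℝ) : UnitAddCircle) = 0 :=
    (AddCircle.coe_eq_zero_iff (1 : ℝ)).2 ⟨⌊(x : ℝ) + α⌋, by simp⟩
  simp [this]

theorem UnitIco.toCircle_iterate_rotationIco (α x : UnitIco) (i : ℕ) :
    ((rotationIco α)^[i] x).toCircle = x.toCircle + (i : ℤ) • α.toCircle := by
  induction i with
  | zero => simp
  | succ i ih =>
    rw [Function.iterate_succ_apply', toCircle_rotationIco, ih]
    push_cast
    rw [add_smul, one_smul, add_assoc]

theorem measurable_iterate_rotationIco (i : ℕ) :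
    Measurable fun p : UnitIco × UnitIco => (rotationIco p.1)^[i] p.2 := by
  induction i with
  | zero => simpa using measurable_snd
  | succ i ih =>
    simp only [Function.iterate_succ_apply']
    have h : Measurable fun q : UnitIco × UnitIco => rotationIco q.1 q.2 :=
      Measurable.subtype_mk (f := fun q : UnitIco × UnitIco => Int.fract ((q.2 : ℝ) + q.1))
        (by fun_prop)
    exact h.comp (measurable_fst.prodMk ih)

/-- Two distinct points of the orbit of a random point under a random rotation are independent
and uniformly distributed. -/
theorem measurePreserving_iterate_rotationIco_prod {i j : ℕ} (hij : i ≠ j) :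
    MeasurePreserving (fun p : UnitIco × UnitIco =>
      ((rotationIco p.1)^[i] p.2, (rotationIco p.1)^[j] p.2))
      (lebesgueIco.prod lebesgueIco) (lebesgueIco.prod lebesgueIco) := by
  have hΦ := UnitIco.measurePreserving_toCircle.prod UnitIco.measurePreserving_toCircle
  refine hΦ.of_comp_measurableEmbedding
    (UnitIco.measurableEmbedding_toCircle.prodMap UnitIco.measurableEmbedding_toCircle)
    ((measurable_iterate_rotationIco i).prodMk (measurable_iterate_rotationIco j)) ?_
  convert (UnitAddCircle.measurePreserving_add_zsmul_prod
    (Nat.cast_injective.ne hij : (i : ℤ) ≠ j)).comp hΦ using 1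
  ext p <;> simp [UnitIco.toCircle_iterate_rotationIco]

theorem measurePreserving_iterate_rotationIco (i : ℕ) :
    MeasurePreserving (fun p : UnitIco × UnitIco => (rotationIco p.1)^[i] p.2)
      (lebesgueIco.prod lebesgueIco) lebesgueIco :=
  measurePreserving_fst.comp (measurePreserving_iterate_rotationIco_prod (Nat.lt_succ_self i).ne)

theorem indepFun_iterate_rotationIco {i j : ℕ} (hij : i ≠ j) :
    IndepFun (fun p : UnitIco × UnitIco => (rotationIco p.1)^[i] p.2)
      (fun p => (rotationIco p.1)^[j] p.2) (lebesgueIco.prod lebesgueIco) := by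
  rw [indepFun_iff_map_prod_eq_prod_map_map (measurable_iterate_rotationIco i).aemeasurable
    (measurable_iterate_rotationIco j).aemeasurable,
    (measurePreserving_iterate_rotationIco i).map_eq,
    (measurePreserving_iterate_rotationIco j).map_eq]
  exact (measurePreserving_iterate_rotationIco_prod hij).map_eq

/-- A ball cut by one endpoint keeps length at least `r` (for `r ≤ 1`); one cut by both is
everything. -/
theorem min_le_lebesgueIco_ball (z : UnitIco) {r : ℝ} (hr : 0 < r) :
    min r 1 ≤ lebesgueIco.real (Metric.ball z r) := by
  obtain ⟨hz0, hz1⟩ := z.2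
  have hsub : Ioo (max (z - r) 0) (min (z + r) 1) ⊆ Subtype.val '' Metric.ball z r := by
    rintro y ⟨h1, h2⟩
    rw [max_lt_iff] at h1
    rw [lt_min_iff] at h2
    refine ⟨⟨y, h1.2.le, h2.2⟩, ?_, rfl⟩
    rw [Metric.mem_ball, Subtype.dist_eq, Real.dist_eq, abs_lt]
    constructor <;> simp only <;> linarith
  refine (ENNReal.ofReal_le_iff_le_toReal (measure_ne_top _ _)).1 ?_
  rw [lebesgueIco_apply]
  refine le_trans ?_ (measure_mono hsub)
  rw [Real.volume_Ioo]
  refine ENNReal.ofReal_le_ofReal ?_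
  rcases min_cases r 1 with h | h <;> rcases max_cases ((z : ℝ) - r) 0 with h' | h' <;>
    rcases min_cases ((z : ℝ) + r) 1 with h'' | h'' <;> linarith

theorem not_summable_min_one {c : ℕ → ℝ} (hc : ¬ Summable c) :
    ¬ Summable fun i => min (c i) 1 := fun h => by
  refine hc (h.congr_atTop ?_)
  filter_upwards [h.tendsto_atTop_zero.eventually_lt_const zero_lt_one] with i hi
  exact min_eq_left ((min_lt_iff.1 hi).resolve_right (lt_irrefl _)).le

/-- Almost every orbit of almost every rotation hits infinitely often any sequence of balls with
non-summable radii. -/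
theorem ae_frequently_dist_iterate_rotationIco_lt (z : ℕ → UnitIco) {b : ℕ → ℝ}
    (hb_pos : ∀ i ≥ 1, 0 < b i) (hb_div : ¬ Summable b) :
    ∀ᵐ p ∂(lebesgueIco.prod lebesgueIco),
      ∃ᶠ i in atTop, dist (z i) ((rotationIco p.1)^[i] p.2) < b i := by
  have hball : ∀ i, MeasurableSet (Metric.ball (z i) (b i)) := fun i =>
    Metric.isOpen_ball.measurableSet
  have key := ae_frequently_mem_of_pairwise_indepFun (μ := lebesgueIco.prod lebesgueIco)
    (E := fun i => (fun p : UnitIco × UnitIco => (rotationIco p.1)^[i] p.2) ⁻¹'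
      Metric.ball (z i) (b i))
    (fun i => measurable_iterate_rotationIco i (hball i)) ?_ ?_
  · filter_upwards [key] with p hp
    exact hp.mono fun i hi => by rwa [dist_comm]
  · intro i j hij
    exact (indepFun_iterate_rotationIco hij).comp
      (measurable_one.indicator (hball i)) (measurable_one.indicator (hball j))
  · intro h
    -- The index is shifted by one because nothing is known about the sign of `b 0`.
    refine not_summable_min_one (mt (summable_nat_add_iff 1).1 hb_div) ?_
    refine Summable.of_nonneg_of_le (fun i => le_min (hb_pos _ (by simp)).le zero_le_one)
      (fun i => ?_) ((summable_nat_add_iff 1).2 h)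
    simp only [measureReal_def]
    rw [(measurePreserving_iterate_rotationIco _).measure_preimage (hball _).nullMeasurableSet]
    exact min_le_lebesgueIco_ball _ (hb_pos _ (by simp))

theorem mem_hittingSet_iff (f : UnitIco → UnitIco) (b : ℕ → ℝ) (α x y : UnitIco) :
    y ∈ hittingSet f b α x ↔ ∃ᶠ i in atTop, dist (f^[i] y) ((rotationIco α)^[i] x) < b i := by
  simp only [hittingSet, mem_iInter, mem_iUnion, mem_preimage, Metric.mem_ball, exists_prop]
  exact (atTop_basis' 1).frequently_iff.symm

theorem IsLebesgueErgodic.aemeasurable_iterate {f : UnitIco → UnitIco} (hf : IsLebesgueErgodic f)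
    (i : ℕ) : AEMeasurable f^[i] lebesgueIco := by
  refine NullMeasurable.aemeasurable fun s hs => ?_
  exact (hf.toMeasurePreserving.iterate i).measurable hs.nullMeasurableSet

theorem theorem2p4 (f : UnitIco → UnitIco) (hf : IsLebesgueErgodic f)
    (b : ℕ → ℝ) (hb_pos : ∀ i ≥ 1, 0 < b i) (hb_anti : AntitoneOn b (Set.Ici 1))
    (hb_div : ¬ Summable b) :
    ∀ᵐ p ∂(lebesgueIco.prod lebesgueIco), lebesgueIco (hittingSet f b p.1 p.2) = 1 := by
  -- The iterates of `f` are only Lebesgue measurable; Borel versions `g i` make the set for Fubini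
  -- measurable.
  choose g hgm hfg using hf.aemeasurable_iterate
  have hmeas : MeasurableSet {q : UnitIco × (UnitIco × UnitIco) |
      ∃ᶠ i in atTop, dist (g i q.1) ((rotationIco q.2.1)^[i] q.2.2) < b i} := by
    simp only [frequently_atTop, ← exists_prop, ofPred_forall, ofPred_exists]
    refine .iInter fun n => .iUnion fun i => .iUnion fun _ => ?_
    exact measurableSet_lt (((hgm i).comp measurable_fst).dist
      ((measurable_iterate_rotationIco i).comp measurable_snd)) measurable_const
  have h : ∀ᵐ y ∂lebesgueIco, ∀ᵐ p ∂(lebesgueIco.prod lebesgueIco),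
      ∃ᶠ i in atTop, dist (g i y) ((rotationIco p.1)^[i] p.2) < b i :=
    ae_of_all _ fun y =>
      ae_frequently_dist_iterate_rotationIco_lt (fun i => g i y) hb_pos hb_div
  rw [Measure.ae_ae_comm hmeas] at h
  filter_upwards [h] with p hp
  refine (measure_congr (eventuallyEq_univ.2 ?_)).trans measure_univ
  filter_upwards [hp, ae_all_iff.2 hfg] with y hy hfgy
  rw [mem_hittingSet_iff]
  simpa only [hfgy] using hy
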